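/- For a pointed space $Y$ let $\Sigma Y$ be its reduced suspension, and for pointed spaces $Y,X$ let $[Y,X]$ be the set of pointed homotopy classes of basepoint preserving maps $Y\to X$; if $Y=\Sigma Y'$ is a suspension, $[Y,X]$ is a group through the suspension coordinate. For $n\ge 1$ let $F_n=\Sigma(T^{n-1}\sqcup *)$ be the $n$-th Fox space, where $T^{n-1}=(\mathbb R/\mathbb Z)^{n-1}$ and the added point $*$ is the basepoint. Let $n>1$. Let $s:F_{n-1}\to F_n$ be the map induced by the inclusion $T^{n-2}\to T^{n-1}$, $x\mapsto (x,0)$, let $r:F_n\to F_{n-1}$ be the map induced by the projection $T^{n-1}\to T^{n-2}$ forgetting the last coordinate, and let $q:F_n\to\Sigma F_{n-1}$ be the suspension of the map $T^{n-1}\sqcup *\to \Sigma(T^{n-2}\sqcup *)=F_{n-1}$, $(x,z)\mapsto[x,z]$, $*\mapsto *$, which collapses $T^{n-2}\sqcup *$ to the basepoint. Then there is a pointed homotopy equivalence $$h: F_n \;\simeq\; \Sigma F_{n-1}\vee F_{n-1}.$$ It is obtained from the natural semidirect product decomposition of $[F_n,X]$. That is, for every pointed space $X$ the sequence of groups $$1\to[\Sigma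 F_{n-1},X]\xrightarrow{\;q^*\;}[F_n,X]\xrightarrow{\;s^*\;}[F_{n-1},X]\to 1$$ is exact and split by $r^*$. There are an action of $[F_{n-1},X]$ on $[\Sigma F_{n-1},X]$ by automorphisms and a group isomorphism, natural in $X$, $$\Theta_X:[\Sigma F_{n-1},X]\rtimes[F_{n-1},X]\xrightarrow{\;\cong\;}[F_n,X],\qquad \Theta_X(a,b)=q^*(a)\,r^*(b).$$ For all $X$ and all $c\in[\Sigma F_{n-1}\vee F_{n-1},X]$ one has $h^*(c)=\Theta_X(c|_{\Sigma F_{n-1}},c|_{F_{n-1}})$. -/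

import Mathlib

open scoped unitInterval

universe u v w

namespace FoxTorus

/-! ### Pointed spaces, pointed maps and pointed homotopy classes -/

/-- A pointed topological space. -/
structure PtdSpace : Type (u + 1) where
  /-- The underlying type. -/
  carrier : Type u
  /-- The topology. -/
  [top : TopologicalSpace carrier]
  /-- The basepoint. -/
  pt : carrier

instance : CoeSort PtdSpace.{u} (Type u) := ⟨PtdSpace.carrier⟩

instance (Y : PtdSpace.{u}) : TopologicalSpace Y := Y.top

/-- Basepoint preserving continuous maps. -/
structure PtdMap (Y : PtdSpace.{u}) (X : PtdSpace.{v}) where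
  /-- The underlying continuous map. -/
  toMap : C(Y, X)
  map_pt : toMap Y.pt = X.pt

namespace PtdMap

variable {Y : PtdSpace.{u}} {X : PtdSpace.{v}} {Z : PtdSpace.{w}}

instance : CoeFun (PtdMap Y X) (fun _ => Y → X) := ⟨fun f => f.toMap⟩

theorem ext {f g : PtdMap Y X} (h : ∀ y, f y = g y) : f = g := by
  cases f; cases g
  congr 1
  exact ContinuousMap.ext h

/-- The identity map. -/
def id (Y : PtdSpace.{u}) : PtdMap Y Y := ⟨ContinuousMap.id Y, rfl⟩

/-- The constant map at the basepoint. -/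
def const (Y : PtdSpace.{u}) (X : PtdSpace.{v}) : PtdMap Y X :=
  ⟨ContinuousMap.const Y X.pt, rfl⟩

/-- `g.comp f` is the map `y ↦ g (f y)`. -/
def comp (g : PtdMap X Z) (f : PtdMap Y X) : PtdMap Y Z :=
  ⟨g.toMap.comp f.toMap, by simp [f.map_pt, g.map_pt]⟩

/-- Homotopy through basepoint preserving maps. -/
def Homotopic (f g : PtdMap Y X) : Prop :=
  f.toMap.HomotopicRel g.toMap {Y.pt}

/-- The map `h` is a pointed homotopy equivalence. -/
def IsHomotopyEquiv (h : PtdMap Y X) : Prop :=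
  ∃ k : PtdMap X Y, (k.comp h).Homotopic (PtdMap.id Y) ∧ (h.comp k).Homotopic (PtdMap.id X)

/-- Pointed homotopy as an equivalence relation. -/
instance homotopySetoid (Y : PtdSpace.{u}) (X : PtdSpace.{v}) : Setoid (PtdMap Y X) where
  r := Homotopic
  iseqv := ⟨fun f => ContinuousMap.HomotopicRel.refl f.toMap, fun h => h.symm,
    fun h h' => h.trans h'⟩

theorem Homotopic.comp_left {f g : PtdMap Y X} (h : f.Homotopic g) (k : PtdMap X Z) :
    (k.comp f).Homotopic (k.comp g) :=
  ContinuousMap.HomotopicRel.comp_continuousMap h k.toMap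

theorem Homotopic.comp_right {f g : PtdMap X Z} (h : f.Homotopic g) (k : PtdMap Y X) :
    (f.comp k).Homotopic (g.comp k) := by
  obtain ⟨H⟩ := h
  refine ⟨⟨⟨⟨fun p => H (p.1, k p.2), ?_⟩, ?_, ?_⟩, ?_⟩⟩
  · have := k.toMap.continuous
    fun_prop
  · intro y
    exact H.apply_zero (k y)
  · intro y
    exact H.apply_one (k y)
  · intro t y hy
    rw [Set.mem_singleton_iff] at hy
    subst hy
    have := H.prop' t (k Y.pt) (by rw [Set.mem_singleton_iff]; exact k.map_pt)
    exact this

end PtdMap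

/-- The set `[Y, X]` of pointed homotopy classes of basepoint preserving maps. -/
def HoClass (Y : PtdSpace.{u}) (X : PtdSpace.{v}) : Type (max u v) :=
  Quotient (PtdMap.homotopySetoid Y X)

namespace HoClass

variable {Y : PtdSpace.{u}} {X : PtdSpace.{v}} {Z : PtdSpace.{w}}

/-- The class of a map. -/
def mk (f : PtdMap Y X) : HoClass Y X := Quotient.mk _ f

/-- `pull k : [X, Z] → [Y, Z]` is precomposition with `k : Y → X`, usually written `k^*`. -/
def pull (k : PtdMap Y X) : HoClass X Z → HoClass Y Z :=
  Quotient.map (fun f => f.comp k) (fun _ _ h => h.comp_right k)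

/-- `push k : [Y, X] → [Y, Z]` is postcomposition with `k : X → Z`, usually written `k_*`. -/
def push (k : PtdMap X Z) : HoClass Y X → HoClass Y Z :=
  Quotient.map (fun f => k.comp f) (fun _ _ h => h.comp_left k)

end HoClass

/-! ### Collapsing a subset to a point; suspensions, wedges, disjoint basepoints -/

/-- The equivalence relation that identifies all points of `S` with one another. -/
def collapseSetoid {Z : Type u} (S : Set Z) : Setoid Z where
  r a b := a = b ∨ (a ∈ S ∧ b ∈ S)
  iseqv := by
    refine ⟨fun a => Or.inl rfl, ?_, ?_⟩
    · rintro a b (h | h)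
      · exact Or.inl h.symm
      · exact Or.inr h.symm
    · rintro a b c (rfl | h) (rfl | h')
      · exact Or.inl rfl
      · exact Or.inr h'
      · exact Or.inr h
      · exact Or.inr ⟨h.1, h'.2⟩

/-- The quotient space `Z / S`, with the quotient topology. -/
abbrev Collapse {Z : Type u} (S : Set Z) : Type u := Quotient (collapseSetoid S)

/-- The subset `Y × {0, 1} ∪ {pt} × [0, 1]` of `Y × [0, 1]`. -/
def suspSet (Y : PtdSpace.{u}) : Set (Y × I) := {p | p.1 = Y.pt ∨ p.2 = 0 ∨ p.2 = 1}

/-- The reduced suspension `ΣY`: the quotient of `Y × [0, 1]` by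
`Y × {0, 1} ∪ {pt} × [0, 1]`. -/
def Susp (Y : PtdSpace.{u}) : PtdSpace.{u} where
  carrier := Collapse (suspSet Y)
  pt := Quotient.mk _ (Y.pt, 0)

/-- The wedge `A ∨ B`: the disjoint union with the two basepoints identified. -/
def Wedge (A : PtdSpace.{u}) (B : PtdSpace.{v}) : PtdSpace.{max u v} where
  carrier := Collapse ({Sum.inl A.pt, Sum.inr B.pt} : Set (A ⊕ B))
  pt := Quotient.mk _ (Sum.inl A.pt)

/-- The space `W ⊔ *` with the added point as basepoint. -/
def AddPt (W : Type u) [TopologicalSpace W] : PtdSpace.{u} where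
  carrier := W ⊕ Unit
  pt := Sum.inr ()

namespace Wedge

/-- The inclusion `A → A ∨ B`. -/
def inl (A : PtdSpace.{u}) (B : PtdSpace.{v}) : PtdMap A (Wedge A B) where
  toMap := ⟨fun a => Quotient.mk _ (Sum.inl a),
    continuous_quotient_mk'.comp continuous_inl⟩
  map_pt := rfl

/-- The inclusion `B → A ∨ B`. -/
def inr (A : PtdSpace.{u}) (B : PtdSpace.{v}) : PtdMap B (Wedge A B) where
  toMap := ⟨fun b => Quotient.mk _ (Sum.inr b),
    continuous_quotient_mk'.comp continuous_inr⟩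
  map_pt := Quotient.sound (Or.inr ⟨by simp, by simp⟩)

end Wedge

namespace AddPt

/-- The pointed map `V ⊔ * → W ⊔ *` induced by a continuous map `V → W`. -/
def map {V : Type u} {W : Type v} [TopologicalSpace V] [TopologicalSpace W] (f : C(V, W)) :
    PtdMap (AddPt V) (AddPt W) where
  toMap := ⟨Sum.map f _root_.id, f.continuous.sumMap continuous_id⟩
  map_pt := rfl

end AddPt

namespace Susp

variable {Y : PtdSpace.{u}} {X : PtdSpace.{v}} {Z : PtdSpace.{w}}

/-- The point `[y, t]` of `ΣY`. -/
def point (Y : PtdSpace.{u}) (y : Y) (t : I) : Susp Y :=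
  Quotient.mk (collapseSetoid (suspSet Y)) (y, t)

theorem continuous_point : Continuous fun p : Y × I => point Y p.1 p.2 :=
  continuous_quotient_mk'

theorem point_eq_pt {y : Y} {t : I} (h : y = Y.pt ∨ t = 0 ∨ t = 1) :
    point Y y t = (Susp Y).pt :=
  Quotient.sound (Or.inr ⟨h, Or.inl rfl⟩)

/-- The loop `t ↦ f [y, t]`. -/
def loop (f : PtdMap (Susp Y) X) (y : Y) : Path X.pt X.pt where
  toFun t := f (point Y y t)
  continuous_toFun := f.toMap.continuous.comp
    (continuous_point.comp (Continuous.prodMk continuous_const continuous_id))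
  source' := by
    rw [point_eq_pt (Or.inr (Or.inl rfl))]
    exact f.map_pt
  target' := by
    rw [point_eq_pt (Or.inr (Or.inr rfl))]
    exact f.map_pt

theorem continuous_loop (f : PtdMap (Susp Y) X) : Continuous ↿(loop f) :=
  f.toMap.continuous.comp continuous_point

theorem loop_pt (f : PtdMap (Susp Y) X) : loop f Y.pt = Path.refl X.pt := by
  ext t
  change f (point Y Y.pt t) = X.pt
  rw [point_eq_pt (Or.inl rfl)]
  exact f.map_pt

/-- The map `ΣY → X`, `[y, t] ↦ γ y t`, given by a continuous family of loops that is constant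
at the basepoint of `Y`. -/
def ofLoops (γ : Y → Path X.pt X.pt) (hγ : Continuous ↿γ) (hpt : γ Y.pt = Path.refl X.pt) :
    PtdMap (Susp Y) X where
  toMap := ⟨Quotient.lift (fun p : Y × I => γ p.1 p.2) (by
      have key : ∀ p : Y × I, p ∈ suspSet Y → γ p.1 p.2 = X.pt := by
        rintro ⟨y, t⟩ (h | h | h)
        · obtain rfl : y = Y.pt := h
          simp [hpt]
        · obtain rfl : t = 0 := h
          simp
        · obtain rfl : t = 1 := h
          simp
      rintro a b (rfl | ⟨ha, hb⟩)
      · rfl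
      · exact (key a ha).trans (key b hb).symm), Continuous.quotient_lift hγ _⟩
  map_pt := (γ Y.pt).source

theorem loop_ofLoops (γ : Y → Path X.pt X.pt) (hγ : Continuous ↿γ)
    (hpt : γ Y.pt = Path.refl X.pt) (y : Y) : loop (ofLoops γ hγ hpt) y = γ y := rfl

theorem ext_loop {f g : PtdMap (Susp Y) X} (h : ∀ y, loop f y = loop g y) : f = g := by
  refine PtdMap.ext fun p => ?_
  induction p using Quotient.inductionOn with
  | h p => exact congrArg (fun γ : Path X.pt X.pt => γ p.2) (h p.1)

theorem homotopic_of_loops {f g : PtdMap (Susp Y) X} (Γ : I × Y → Path X.pt X.pt)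
    (hΓ : Continuous ↿Γ) (hpt : ∀ s, Γ (s, Y.pt) = Path.refl X.pt)
    (h0 : ∀ y, Γ (0, y) = loop f y) (h1 : ∀ y, Γ (1, y) = loop g y) : f.Homotopic g := by
  have hq : Topology.IsQuotientMap (Quotient.mk (collapseSetoid (suspSet Y))) :=
    isQuotientMap_quotient_mk'
  let F : I → PtdMap (Susp Y) X := fun s =>
    ofLoops (fun y => Γ (s, y))
      (hΓ.comp (f := fun p : Y × I => ((s, p.1), p.2)) (by fun_prop)) (hpt s)
  have hF0 : F 0 = f := ext_loop h0
  have hF1 : F 1 = g := ext_loop h1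
  refine ⟨⟨⟨⟨fun p => F p.1 p.2, ?_⟩, ?_, ?_⟩, ?_⟩⟩
  · refine hq.continuous_lift_prod_right ?_
    exact hΓ.comp (f := fun p : I × (Y × I) => ((p.1, p.2.1), p.2.2)) (by fun_prop)
  · intro p
    change F 0 p = f p
    rw [hF0]
  · intro p
    change F 1 p = g p
    rw [hF1]
  · intro s p hp
    rw [Set.mem_singleton_iff] at hp
    subst hp
    exact (F s).map_pt.trans f.map_pt.symm

theorem loops_of_homotopic {f g : PtdMap (Susp Y) X} (h : f.Homotopic g) :
    ∃ Γ : I × Y → Path X.pt X.pt, Continuous ↿Γ ∧ (∀ s, Γ (s, Y.pt) = Path.refl X.pt) ∧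
      (∀ y, Γ (0, y) = loop f y) ∧ (∀ y, Γ (1, y) = loop g y) := by
  obtain ⟨H⟩ := h
  have hc : Continuous fun p : (I × Y) × I => H (p.1.1, point Y p.1.2 p.2) :=
    H.continuous.comp (continuous_fst.fst.prodMk
      (continuous_point.comp (continuous_fst.snd.prodMk continuous_snd)))
  have hH : ∀ s, H (s, (Susp Y).pt) = X.pt := fun s =>
    (H.prop' s (Susp Y).pt rfl).trans f.map_pt
  refine ⟨fun q => ⟨⟨fun t => H (q.1, point Y q.2 t),
    hc.comp (f := fun t => (q, t)) (by fun_prop)⟩, ?_, ?_⟩, hc, ?_, ?_, ?_⟩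
  · change H (q.1, point Y q.2 0) = X.pt
    rw [point_eq_pt (Or.inr (Or.inl rfl)), hH]
  · change H (q.1, point Y q.2 1) = X.pt
    rw [point_eq_pt (Or.inr (Or.inr rfl)), hH]
  · intro s
    ext t
    change H (s, point Y Y.pt t) = X.pt
    rw [point_eq_pt (Or.inl rfl), hH]
  · intro y
    ext t
    exact H.apply_zero _
  · intro y
    ext t
    exact H.apply_one _

/-- The suspension `Σk : ΣY → ΣZ`, `[y, t] ↦ [k y, t]`, of a pointed map. -/
def map (k : PtdMap Y Z) : PtdMap (Susp Y) (Susp Z) :=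
  ofLoops (fun y => loop (PtdMap.id (Susp Z)) (k y))
    ((continuous_loop (PtdMap.id (Susp Z))).comp
      (k.toMap.continuous.prodMap continuous_id))
    (by rw [k.map_pt]; exact loop_pt _)

/-! ### The group `[ΣY, X]` -/

/-- The sum of two maps out of a suspension:
`[y, t] ↦ f [y, 2t]` for `t ≤ 1/2` and `[y, t] ↦ g [y, 2t - 1]` for `t ≥ 1/2`. -/
noncomputable def mulMap (f g : PtdMap (Susp Y) X) : PtdMap (Susp Y) X :=
  ofLoops (fun y => (loop f y).trans (loop g y))
    (Path.trans_continuous_family _ (continuous_loop f) _ (continuous_loop g))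
    (by rw [loop_pt, loop_pt, Path.refl_trans_refl])

/-- The reversed map `[y, t] ↦ f [y, 1 - t]`. -/
def invMap (f : PtdMap (Susp Y) X) : PtdMap (Susp Y) X :=
  ofLoops (fun y => (loop f y).symm)
    (Path.symm_continuous_family _ (continuous_loop f))
    (by rw [loop_pt, Path.refl_symm])

theorem mulMap_homotopic {f f' g g' : PtdMap (Susp Y) X} (hf : f.Homotopic f')
    (hg : g.Homotopic g') : (mulMap f g).Homotopic (mulMap f' g') := by
  obtain ⟨Γ, hΓ, hp, h0, h1⟩ := loops_of_homotopic hf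
  obtain ⟨Δ, hΔ, hp', h0', h1'⟩ := loops_of_homotopic hg
  refine homotopic_of_loops (fun q => (Γ q).trans (Δ q))
    (Path.trans_continuous_family _ hΓ _ hΔ) ?_ ?_ ?_
  · intro s
    simp only [hp, hp', Path.refl_trans_refl]
  · intro y
    simp only [h0, h0']
    rfl
  · intro y
    simp only [h1, h1']
    rfl

theorem invMap_homotopic {f f' : PtdMap (Susp Y) X} (hf : f.Homotopic f') :
    (invMap f).Homotopic (invMap f') := by
  obtain ⟨Γ, hΓ, hp, h0, h1⟩ := loops_of_homotopic hf
  refine homotopic_of_loops (fun q => (Γ q).symm) (Path.symm_continuous_family _ hΓ) ?_ ?_ ?_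
  · intro s
    simp only [hp, Path.refl_symm]
  · intro y
    simp only [h0]
    rfl
  · intro y
    simp only [h1]
    rfl

theorem homotopic_of_reparam {f g : PtdMap (Susp Y) X} (θ : I → I) (hθ : Continuous θ)
    (θ0 : θ 0 = 0) (θ1 : θ 1 = 1) (h : ∀ y, loop g y = (loop f y).reparam θ hθ θ0 θ1) :
    f.Homotopic g := by
  let H := fun y => Path.Homotopy.reparam (loop f y) θ hθ θ0 θ1
  refine homotopic_of_loops (fun q => (H q.2).eval q.1) ?_ ?_ ?_ ?_
  · refine (continuous_loop f).comp (f := fun p : (I × Y) × I => (p.1.2, (⟨_, _⟩ : I))) ?_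
    refine Continuous.prodMk (by fun_prop) (Continuous.subtype_mk ?_ _)
    fun_prop
  · intro s
    ext t
    change loop f Y.pt _ = X.pt
    rw [loop_pt]
    rfl
  · intro y
    exact (H y).eval_zero
  · intro y
    exact ((H y).eval_one).trans (h y).symm

theorem mulMap_assoc (f g h : PtdMap (Susp Y) X) :
    (mulMap f (mulMap g h)).Homotopic (mulMap (mulMap f g) h) :=
  homotopic_of_reparam _ _ _ _
    (fun y => Path.Homotopy.trans_assoc_reparam (loop f y) (loop g y) (loop h y))

theorem mulMap_const (f : PtdMap (Susp Y) X) :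
    f.Homotopic (mulMap f (PtdMap.const _ _)) :=
  homotopic_of_reparam _ _ _ _ (fun y => Path.Homotopy.trans_refl_reparam (loop f y))

theorem mulMap_invMap (f : PtdMap (Susp Y) X) :
    (PtdMap.const _ _).Homotopic (mulMap f (invMap f)) := by
  let H := fun y => Path.Homotopy.reflTransSymm (loop f y)
  refine homotopic_of_loops (fun q => (H q.2).eval q.1) ?_ ?_ ?_ ?_
  · refine (continuous_loop f).comp (f := fun p : (I × Y) × I => (p.1.2, (⟨_, _⟩ : I))) ?_
    refine Continuous.prodMk (by fun_prop) (Continuous.subtype_mk ?_ _)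
    exact Path.Homotopy.continuous_reflTransSymmAux.comp (by fun_prop)
  · intro s
    ext t
    change loop f Y.pt _ = X.pt
    rw [loop_pt]
    rfl
  · intro y
    exact (H y).eval_zero
  · intro y
    exact (H y).eval_one

instance : One (HoClass (Susp Y) X) := ⟨HoClass.mk (PtdMap.const _ _)⟩

noncomputable instance : Mul (HoClass (Susp Y) X) :=
  ⟨Quotient.map₂ mulMap (fun _ _ h _ _ h' => mulMap_homotopic h h')⟩

noncomputable instance : Inv (HoClass (Susp Y) X) :=
  ⟨Quotient.map invMap (fun _ _ h => invMap_homotopic h)⟩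

/-- The group structure on `[ΣY, X]` coming from the suspension coordinate. -/
noncomputable instance : Group (HoClass (Susp Y) X) :=
  Group.ofRightAxioms
    (by
      intro a b c
      induction a using Quotient.inductionOn
      induction b using Quotient.inductionOn
      induction c using Quotient.inductionOn
      exact (Quotient.sound (mulMap_assoc _ _ _)).symm)
    (by
      intro a
      induction a using Quotient.inductionOn
      exact (Quotient.sound (mulMap_const _)).symm)
    (by
      intro a
      induction a using Quotient.inductionOn
      exact (Quotient.sound (mulMap_invMap _)).symm)

/-- The homomorphism `(Σk)^* : [ΣZ, X] → [ΣY, X]`, for a pointed map `k : Y → Z`. -/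
noncomputable def pullHom (k : PtdMap Y Z) (X : PtdSpace.{v}) :
    HoClass (Susp Z) X →* HoClass (Susp Y) X :=
  MonoidHom.mk' (HoClass.pull (map k)) (by
    intro a b
    induction a using Quotient.inductionOn
    induction b using Quotient.inductionOn
    exact congrArg HoClass.mk (ext_loop fun _ => rfl))

end Susp

/-! ### Tori and Fox spaces -/

/-- The torus `T^k`, the product of `k` circles `ℝ/ℤ`. -/
abbrev Torus (k : ℕ) : Type := Fin k → UnitAddCircle

/-- The Fox space `F_n = Σ(T^{n-1} ⊔ *)`, for `n ≥ 1`. -/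
abbrev FoxSpace (n : ℕ) : PtdSpace.{0} := Susp (AddPt (Torus (n - 1)))

/-- The projection `T^{n-1} → T^{n-2}` that forgets the last coordinate. -/
def torusProj (n : ℕ) : C(Torus (n - 1), Torus (n - 1 - 1)) :=
  ⟨fun x i => x (Fin.castLE (Nat.sub_le _ _) i), by fun_prop⟩

/-- The inclusion `T^{n-2} → T^{n-1}` whose last coordinate is the basepoint of the circle. -/
def torusIncl (n : ℕ) : C(Torus (n - 1 - 1), Torus (n - 1)) :=
  ⟨fun x i => if h : (i : ℕ) < n - 1 - 1 then x ⟨i, h⟩ else 0, by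
    refine continuous_pi fun i => ?_
    split_ifs <;> fun_prop⟩

/-- The last coordinate of a point of `T^{n-1}`, for `n > 1`. -/
def torusLast (n : ℕ) (hn : 1 < n) (x : Torus (n - 1)) : UnitAddCircle :=
  x ⟨n - 1 - 1, by omega⟩

/-- The representative in `[0, 1)` of a point of the circle `ℝ/ℤ`. -/
noncomputable def circleParam (z : UnitAddCircle) : I :=
  ⟨AddCircle.equivIco (1 : ℝ) 0 z, by
    have h := (AddCircle.equivIco (1 : ℝ) 0 z).2
    exact ⟨h.1, by simpa using h.2.le⟩⟩

theorem continuous_point_circleParam (Y : PtdSpace.{u}) :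
    Continuous fun p : Y × UnitAddCircle => Susp.point Y p.1 (circleParam p.2) := by
  have hq : IsOpenQuotientMap
      (Prod.map _root_.id ((↑) : ℝ → UnitAddCircle) : Y × ℝ → Y × UnitAddCircle) :=
    IsOpenQuotientMap.id.prodMap QuotientAddGroup.isOpenQuotientMap_mk
  refine hq.isQuotientMap.continuous_iff.mpr ?_
  let f : Y → ℝ → Susp Y := fun y t => Susp.point Y y (Set.projIcc 0 1 zero_le_one t)
  have hf : Continuous (Function.uncurry f) :=
    Susp.continuous_point.comp
      (continuous_fst.prodMk ((continuous_projIcc (h := zero_le_one)).comp continuous_snd))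
  have hf01 : ∀ y, f y 0 = f y 1 := by
    intro y
    simp only [f, Set.projIcc_left, Set.projIcc_right]
    exact (Susp.point_eq_pt (Or.inr (Or.inl rfl))).trans
      (Susp.point_eq_pt (Or.inr (Or.inr rfl))).symm
  convert ContinuousOn.comp_fract' hf.continuousOn hf01 using 1
  funext p
  change Susp.point Y p.1 (circleParam (p.2 : UnitAddCircle)) = _
  congr 1
  have h : ((circleParam (p.2 : UnitAddCircle) : I) : ℝ) = Int.fract p.2 := by
    change (AddCircle.equivIco (1 : ℝ) 0 (QuotientAddGroup.mk p.2) : ℝ) = _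
    rw [AddCircle.coe_equivIco_mk_apply]
    simp
  refine Subtype.ext ?_
  rw [h, Set.projIcc_of_mem zero_le_one ⟨Int.fract_nonneg _, (Int.fract_lt_one _).le⟩]

/-- The map `T^{n-1} ⊔ * → Σ(T^{n-2} ⊔ *) = F_{n-1}`, `x ↦ [(x_1, …, x_{n-2}), x_{n-1}]`, which
collapses `T^{n-2} ⊔ *` to the basepoint and identifies the quotient with `F_{n-1}`. -/
noncomputable def torusCollapse (n : ℕ) (hn : 1 < n) :
    PtdMap (AddPt (Torus (n - 1))) (FoxSpace (n - 1)) where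
  toMap := ⟨Sum.elim
      (fun x => Susp.point (AddPt (Torus (n - 1 - 1))) (Sum.inl (torusProj n x))
        (circleParam (torusLast n hn x)))
      (fun _ => (FoxSpace (n - 1)).pt), by
    refine Continuous.sumElim ?_ continuous_const
    refine (continuous_point_circleParam (AddPt (Torus (n - 1 - 1)))).comp
      (f := fun x => ((Sum.inl (torusProj n x) : AddPt (Torus (n - 1 - 1))),
        torusLast n hn x)) ?_
    exact (continuous_inl.comp (torusProj n).continuous).prodMk (continuous_apply _)⟩
  map_pt := rfl

/-- The homomorphism `[F_n, X] → [F_{n-1}, X]` induced by the inclusion `T^{n-2} → T^{n-1}`. -/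
noncomputable def foxRestrict (n : ℕ) (X : PtdSpace.{u}) :
    HoClass (FoxSpace n) X →* HoClass (FoxSpace (n - 1)) X :=
  Susp.pullHom (AddPt.map (torusIncl n)) X

/-- The homomorphism `[F_{n-1}, X] → [F_n, X]` induced by the projection `T^{n-1} → T^{n-2}`. -/
noncomputable def foxSection (n : ℕ) (X : PtdSpace.{u}) :
    HoClass (FoxSpace (n - 1)) X →* HoClass (FoxSpace n) X :=
  Susp.pullHom (AddPt.map (torusProj n)) X

/-- The homomorphism `[ΣF_{n-1}, X] → [F_n, X]` induced by the suspension of the collapse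
`T^{n-1} ⊔ * → F_{n-1}`. -/
noncomputable def foxKernelMap (n : ℕ) (hn : 1 < n) (X : PtdSpace.{u}) :
    HoClass (Susp (FoxSpace (n - 1))) X →* HoClass (FoxSpace n) X :=
  Susp.pullHom (torusCollapse n hn) X

end FoxTorus

open FoxTorus

namespace FoxTorus

/-! ### Cylinders of loops and their normalization at the base of the circle -/

section Cylinder

variable {B : Type u} {X : PtdSpace.{v}}

/-! Write `W ≅ A × S¹` with `A = T^{n-2}`, so that maps `Σ(W ⊔ *) → X` are families of loops over `A
× S¹`, that is, cylinders `G (a, t, u)` periodic in `t`. The composite of the inclusion of `A` with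
the projection is the identity, and its composite with the collapse is constant. Hence `s^* r^* = 1`
and `s^* q^*` is trivial; what remains is that `q^*` is injective and that its image contains the
kernel of `s^*`.

Both follow from one construction. The cylinder `G (a, t, ·) * G (a, 0, ·)⁻¹` represents `f · (r^*
s^* f)⁻¹`. Over `t = 0` it is a loop followed by its inverse, hence canonically contractible.
Attaching this contraction as a collar at both ends extends the cylinder to `[-1, 2]`, and
stretching `[0, 1]` to `[-1, 2]` deforms it, through periodic cylinders, to one that is constant
over the base of the circle. The result is a map `normalize e f` on `ΣΣ(A ⊔ *)` whose pullback is `f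
· (r^* s^* f)⁻¹` (`pull_normalize`), which gives the kernel. The construction respects homotopies
(`normalize_homotopic`) and undoes `q^*` (`normalize_pull`), which gives injectivity.

The split extension yields `Θ`. The map `h` is the product in `[F_n, ΣF_{n-1} ∨ F_{n-1}]` of `q` and
`r` followed by the wedge inclusions. Postcomposition is a homomorphism, so `h^*` is `Θ` and
therefore bijective for every `X`; a Yoneda argument makes `h` an equivalence. -/

/-- The nearest point of `[0, 1]`. -/
noncomputable def clamp (τ : ℝ) : I := Set.projIcc 0 1 zero_le_one τ

theorem continuous_clamp : Continuous clamp :=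
  continuous_projIcc (h := zero_le_one)

theorem clamp_coe (t : I) : clamp t = t := Set.projIcc_val zero_le_one t

theorem clamp_of_nonpos {τ : ℝ} (h : τ ≤ 0) : clamp τ = 0 := Set.projIcc_of_le_left _ h

theorem clamp_of_one_le {τ : ℝ} (h : 1 ≤ τ) : clamp τ = 1 := Set.projIcc_of_right_le _ h

/-- The distance of a real number from `[0, 1]`. -/
def overshoot (τ : ℝ) : ℝ := max 0 (max (-τ) (τ - 1))

theorem continuous_overshoot : Continuous overshoot := by
  unfold overshoot
  fun_prop

theorem overshoot_coe (t : I) : overshoot t = 0 := by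
  have h0 := t.2.1
  have h1 := t.2.2
  exact max_eq_left (max_le (by linarith) (by linarith))

theorem overshoot_neg {s : ℝ} (h : 0 ≤ s) : overshoot (-s) = s := by
  unfold overshoot
  rw [neg_neg, max_eq_left (by linarith : -s - 1 ≤ s), max_eq_right h]

theorem overshoot_one_add {s : ℝ} (h : 0 ≤ s) : overshoot (1 + s) = s := by
  unfold overshoot
  rw [max_eq_right (by linarith : -(1 + s) ≤ 1 + s - 1), max_eq_right (by linarith)]
  ring

/-- For `τ ∈ [0, 1]` the loop `G (b, τ, ·)` followed by the inverse of `G (b, 0, ·)`; for `τ`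
outside of `[0, 1]` the canonical contraction of `G (b, 0, ·)` followed by its inverse. -/
noncomputable def slide (G : B × I × I → X) (b : B) (τ : ℝ) (u : I) : X :=
  if (u : ℝ) ≤ 1 / 2 then G (b, clamp τ, clamp (min (2 * u) (1 - overshoot τ)))
  else G (b, 0, clamp (min (2 - 2 * u) (1 - overshoot τ)))

variable {G : B × I × I → X}

/-- At `-s` both branches read only the loop over `t = 0`. Thus a cylinder already constant there
stays constant there throughout the homotopy. -/
theorem slide_neg_of_base (b : B) (hb : ∀ u, G (b, 0, u) = X.pt) {s : ℝ}
    (h : 0 ≤ s) (u : I) : slide G b (-s) u = X.pt := by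
  unfold slide
  rw [clamp_of_nonpos (by linarith), hb, hb, ite_self]

theorem slide_coe (b : B) (t u : I) : slide G b t u =
    if (u : ℝ) ≤ 1 / 2 then G (b, t, clamp (2 * u)) else G (b, 0, clamp (2 - 2 * u)) := by
  have h1 := u.2.2
  unfold slide
  rw [overshoot_coe, clamp_coe]
  split_ifs with h
  · rw [min_eq_left (by linarith)]
  · rw [min_eq_left (by linarith)]

/-- The linear homotopy from the inclusion `[0, 1] ⊆ [-1, 2]` to the affine bijection. -/
def stretch (s t : I) : ℝ := t + s * (2 * t - 1)

theorem continuous_stretch : Continuous fun p : I × I => stretch p.1 p.2 := by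
  unfold stretch
  fun_prop

theorem stretch_zero (t : I) : stretch 0 t = t := by simp [stretch]

theorem stretch_left (s : I) : stretch s 0 = -(s : ℝ) := by simp [stretch]

theorem stretch_right (s : I) : stretch s 1 = 1 + (s : ℝ) := by
  simp only [stretch, Set.Icc.coe_one]
  ring

/-- The homotopy from the cylinder `G (b, t, ·) * G (b, 0, ·)⁻¹` to a cylinder that is constant
over `t = 0`. -/
noncomputable def slideHomotopy (G : B × I × I → X) (s : I) (p : B × I × I) : X :=
  slide G p.1 (stretch s p.2.1) p.2.2

theorem slideHomotopy_base (s : I) (b : B) (hb : ∀ u, G (b, 0, u) = X.pt)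
    (u : I) : slideHomotopy G s (b, 0, u) = X.pt := by
  simp only [slideHomotopy, stretch_left]
  exact slide_neg_of_base b hb s.2.1 u

theorem slideHomotopy_zero (b : B) (t u : I) : slideHomotopy G 0 (b, t, u) =
    if (u : ℝ) ≤ 1 / 2 then G (b, t, clamp (2 * u)) else G (b, 0, clamp (2 - 2 * u)) := by
  simp only [slideHomotopy, stretch_zero]
  exact slide_coe b t u

/-! ### Periodicity and continuity of the normalizing homotopy -/

variable [TopologicalSpace B]

/-- A family of loops in `X` parametrized by `B × (ℝ/ℤ)`, written as a function of `b`, the circle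
coordinate in `[0, 1]` and the loop coordinate. -/
structure IsLoopCylinder (G : B × I × I → X) : Prop where
  continuous : Continuous G
  periodic : ∀ b u, G (b, 0, u) = G (b, 1, u)
  left : ∀ b t, G (b, t, 0) = X.pt
  right : ∀ b t, G (b, t, 1) = X.pt

namespace IsLoopCylinder

/-- The two branches of `slide` agree at `u = 1 / 2`: inside `[0, 1]` both loops have reached their
endpoint, and outside it periodicity turns the loop over `clamp τ` into the one over `0`. -/
theorem base_eq_clamp (hG : IsLoopCylinder G) (b : B) (τ : ℝ) :
    G (b, clamp τ, clamp (1 - overshoot τ)) = G (b, 0, clamp (1 - overshoot τ)) := by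
  rcases le_total τ 0 with h | h
  · rw [clamp_of_nonpos h]
  rcases le_total 1 τ with h' | h'
  · rw [clamp_of_one_le h', hG.periodic]
  · have : overshoot τ = 0 := overshoot_coe ⟨τ, h, h'⟩
    rw [this, sub_zero, clamp_of_one_le le_rfl, hG.right, hG.right]

theorem continuous_slide (hG : IsLoopCylinder G) :
    Continuous fun p : B × ℝ × I => slide G p.1 p.2.1 p.2.2 := by
  have hc := continuous_clamp
  have ho := continuous_overshoot
  have hg := hG.continuous
  unfold slide
  refine Continuous.if_le ?_ ?_ (by fun_prop) continuous_const ?_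
  · fun_prop
  · fun_prop
  · rintro ⟨b, τ, u⟩ (h : (u : ℝ) = 1 / 2)
    have ho : 0 ≤ overshoot τ := le_max_left _ _
    simp only [h]
    rw [min_eq_right (by linarith), min_eq_right (by linarith), hG.base_eq_clamp]

theorem slide_left (hG : IsLoopCylinder G) (b : B) (τ : ℝ) : slide G b τ 0 = X.pt := by
  unfold slide
  rw [if_pos (by norm_num), clamp_of_nonpos (min_le_of_left_le (by norm_num)), hG.left]

theorem slide_right (hG : IsLoopCylinder G) (b : B) (τ : ℝ) : slide G b τ 1 = X.pt := by
  unfold slide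
  rw [if_neg (by norm_num), clamp_of_nonpos (min_le_of_left_le (by norm_num)), hG.left]

theorem slide_eq_pt (hG : IsLoopCylinder G) (b : B) {τ : ℝ} (h : 1 ≤ overshoot τ) (u : I) :
    slide G b τ u = X.pt := by
  unfold slide
  split_ifs
  · rw [clamp_of_nonpos (min_le_of_right_le (by linarith)), hG.left]
  · rw [clamp_of_nonpos (min_le_of_right_le (by linarith)), hG.left]

/-- The collars at the two ends coincide, so each stage of the stretching still closes up to a
family over the circle. -/
theorem slide_neg (hG : IsLoopCylinder G) (b : B) {s : ℝ} (h : 0 ≤ s) (u : I) :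
    slide G b (-s) u = slide G b (1 + s) u := by
  unfold slide
  rw [overshoot_neg h, overshoot_one_add h, clamp_of_nonpos (by linarith : -s ≤ 0),
    clamp_of_one_le (by linarith : 1 ≤ 1 + s), hG.periodic]

theorem continuous_slideHomotopy (hG : IsLoopCylinder G) :
    Continuous fun p : I × B × I × I => slideHomotopy G p.1 p.2 :=
  hG.continuous_slide.comp (f := fun p : I × B × I × I =>
    (p.2.1, stretch p.1 p.2.2.1, p.2.2.2)) (by
      have := continuous_stretch
      fun_prop)

theorem slideHomotopy_isLoopCylinder (hG : IsLoopCylinder G) (s : I) :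
    IsLoopCylinder (slideHomotopy G s) where
  continuous := hG.continuous_slideHomotopy.comp (by fun_prop : Continuous fun p => (s, p))
  periodic b u := by
    simp only [slideHomotopy, stretch_left, stretch_right]
    exact hG.slide_neg b s.2.1 u
  left b t := hG.slide_left b _
  right b t := hG.slide_right b _

theorem slideHomotopy_one_base (hG : IsLoopCylinder G) (b : B) (u : I) :
    slideHomotopy G 1 (b, 0, u) = X.pt := by
  refine hG.slide_eq_pt b ?_ u
  rw [stretch_left, Set.Icc.coe_one, overshoot_neg zero_le_one]

end IsLoopCylinder

end Cylinder

/-! ### The circle as a quotient of the interval -/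

section Circle

theorem circleParam_coe_of_lt {t : ℝ} (h0 : 0 ≤ t) (h1 : t < 1) :
    (circleParam (t : UnitAddCircle) : ℝ) = t := by
  change (AddCircle.equivIco (1 : ℝ) 0 (QuotientAddGroup.mk t) : ℝ) = _
  rw [AddCircle.coe_equivIco_mk_apply]
  simpa using Int.fract_eq_self.mpr ⟨h0, h1⟩

theorem circleParam_zero : circleParam 0 = 0 :=
  Subtype.ext (circleParam_coe_of_lt le_rfl zero_lt_one)

theorem coe_circleParam (z : UnitAddCircle) : ((circleParam z : ℝ) : UnitAddCircle) = z :=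
  (AddCircle.equivIco (1 : ℝ) 0).symm_apply_apply z

/-- The round trip through the circle moves only `t = 1`, which it sends to `0`. -/
theorem apply_circleParam {T : Type u} (F : I → T) (h : F 0 = F 1) (t : I) :
    F (circleParam ((t : ℝ) : UnitAddCircle)) = F t := by
  rcases t.2.2.lt_or_eq with h1 | h1
  · exact congrArg F (Subtype.ext (circleParam_coe_of_lt t.2.1 h1))
  · have ht : t = 1 := Subtype.ext h1
    subst ht
    have : (((1 : I) : ℝ) : UnitAddCircle) = 0 := AddCircle.coe_period (1 : ℝ)
    rw [this, circleParam_zero, h]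

/-- `circleParam` jumps at `0`, but equal values of `F` at the two ends hide the jump. -/
theorem continuous_comp_circleParam {Z : Type u} {T : Type v} [TopologicalSpace Z]
    [TopologicalSpace T] {F : Z × I → T} (hF : Continuous F) (h : ∀ z, F (z, 0) = F (z, 1)) :
    Continuous fun p : Z × UnitAddCircle => F (p.1, circleParam p.2) := by
  -- Openness matters: open quotient maps remain quotient maps after taking the product with an
  -- arbitrary `Z`.
  have hq : IsOpenQuotientMap
      (Prod.map _root_.id ((↑) : ℝ → UnitAddCircle) : Z × ℝ → Z × UnitAddCircle) :=
    IsOpenQuotientMap.id.prodMap QuotientAddGroup.isOpenQuotientMap_mk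
  refine hq.isQuotientMap.continuous_iff.mpr ?_
  let f : Z → ℝ → T := fun z t => F (z, clamp t)
  have hf : Continuous (Function.uncurry f) :=
    hF.comp (continuous_fst.prodMk (continuous_clamp.comp continuous_snd))
  have hf01 : ∀ z, f z 0 = f z 1 := by
    intro z
    simp only [f, clamp_of_nonpos le_rfl, clamp_of_one_le le_rfl, h]
  convert ContinuousOn.comp_fract' hf.continuousOn hf01 using 1
  funext p
  change F (p.1, circleParam (p.2 : UnitAddCircle)) = F (p.1, clamp (Int.fract p.2))
  congr 2
  refine Subtype.ext ?_
  change (AddCircle.equivIco (1 : ℝ) 0 (QuotientAddGroup.mk p.2) : ℝ) = _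
  rw [AddCircle.coe_equivIco_mk_apply, clamp,
    Set.projIcc_of_mem zero_le_one ⟨Int.fract_nonneg _, (Int.fract_lt_one _).le⟩]
  simp

end Circle

/-! ### Maps out of suspensions of spaces with a disjoint basepoint -/

section Construction

variable {A : Type u} [TopologicalSpace A] {X : PtdSpace.{v}}

/-- The inclusion `A → A ⊔ *`. -/
def AddPt.of (a : A) : AddPt A := Sum.inl a

theorem AddPt.continuous_of : Continuous (AddPt.of : A → AddPt A) := continuous_inl

theorem Susp.point_zero {Y : PtdSpace.{u}} (y : Y) : Susp.point Y y 0 = (Susp Y).pt :=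
  Susp.point_eq_pt (Or.inr (Or.inl rfl))

theorem Susp.point_one {Y : PtdSpace.{u}} (y : Y) : Susp.point Y y 1 = (Susp Y).pt :=
  Susp.point_eq_pt (Or.inr (Or.inr rfl))

theorem Susp.point_pt {Y : PtdSpace.{u}} (t : I) : Susp.point Y Y.pt t = (Susp Y).pt :=
  Susp.point_eq_pt (Or.inl rfl)

theorem Susp.induction {Y : PtdSpace.{u}} {p : Susp Y → Prop} (h : ∀ y t, p (Susp.point Y y t))
    (x : Susp Y) : p x :=
  Quotient.inductionOn x fun q => h q.1 q.2

theorem Susp.addPt_induction {p : Susp (AddPt A) → Prop} (hpt : p (Susp (AddPt A)).pt)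
    (h : ∀ a t, p (Susp.point (AddPt A) (AddPt.of a) t)) (x : Susp (AddPt A)) : p x := by
  refine Susp.induction (fun y t => ?_) x
  rcases y with a | ⟨⟩
  · exact h a t
  · exact (Susp.point_pt (Y := AddPt A) t).symm ▸ hpt

/-- The pointed space of maps `Z → X`, based at the constant map. -/
abbrev mapSpace (Z : Type u) [TopologicalSpace Z] (X : PtdSpace.{v}) : PtdSpace.{max u v} where
  carrier := C(Z, X)
  pt := ContinuousMap.const Z X.pt

/-- The map `Σ(A ⊔ *) → X`, `[a, t] ↦ F (a, t)`. -/
def Susp.ofAddPt (F : C(A × I, X)) (h0 : ∀ a, F (a, 0) = X.pt) (h1 : ∀ a, F (a, 1) = X.pt) :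
    PtdMap (Susp (AddPt A)) X :=
  Susp.ofLoops
    (Sum.elim (fun a => ⟨F.curry a, h0 a, h1 a⟩) (fun _ => Path.refl X.pt))
    (by
      have hc : Continuous (Sum.elim (fun a => F.curry a)
          (fun _ : Unit => ContinuousMap.const I X.pt)) :=
        Continuous.sumElim F.curry.continuous continuous_const
      refine (ContinuousMap.continuous_uncurry_of_continuous ⟨_, hc⟩).congr ?_
      rintro ⟨a | ⟨⟩, t⟩ <;> rfl)
    rfl

/-- Extending a family of maps `A × I → X` to a family of maps `Σ(A ⊔ *) → X`. -/
theorem Susp.exists_continuous_addPt {Z : Type w} [TopologicalSpace Z] [LocallyCompactSpace Z]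
    (F : C((A × I) × Z, X)) (h0 : ∀ a z, F ((a, 0), z) = X.pt)
    (h1 : ∀ a z, F ((a, 1), z) = X.pt) :
    ∃ Φ : C(Susp (AddPt A) × Z, X), (∀ z, Φ ((Susp (AddPt A)).pt, z) = X.pt) ∧
      ∀ a t z, Φ (Susp.point (AddPt A) (AddPt.of a) t, z) = F ((a, t), z) := by
  -- The product of a quotient map with `Z` is avoided: the adjoint map into `C(Z, X)` descends to
  -- the suspension, and local compactness of `Z` makes its uncurrying continuous.
  let f : PtdMap (Susp (AddPt A)) (mapSpace Z X) :=
    Susp.ofAddPt F.curry (fun a => ContinuousMap.ext (h0 a)) (fun a => ContinuousMap.ext (h1 a))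
  refine ⟨f.toMap.uncurry, fun z => ?_, fun a t z => rfl⟩
  exact congrArg (fun g : C(Z, X) => g z) f.map_pt

/-- Two maps `Σ(A ⊔ *) → X` are homotopic if the associated families of loops are freely
homotopic. -/
theorem Susp.homotopic_of_addPt {f g : PtdMap (Susp (AddPt A)) X} (K : I × A × I → X)
    (hK : Continuous K) (hl : ∀ s a, K (s, a, 0) = X.pt) (hr : ∀ s a, K (s, a, 1) = X.pt)
    (h0 : ∀ a u, K (0, a, u) = f (Susp.point (AddPt A) (AddPt.of a) u))
    (h1 : ∀ a u, K (1, a, u) = g (Susp.point (AddPt A) (AddPt.of a) u)) : f.Homotopic g := by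
  obtain ⟨Φ, hpt, hΦ⟩ := Susp.exists_continuous_addPt
    (⟨fun p : (A × I) × I => K (p.2, p.1.1, p.1.2), by fun_prop⟩ : C((A × I) × I, X))
    (fun a z => hl z a) (fun a z => hr z a)
  refine ⟨⟨⟨⟨fun p => Φ (p.2, p.1), by fun_prop⟩, ?_, ?_⟩, ?_⟩⟩
  · refine Susp.addPt_induction ?_ fun a t => ?_
    · exact (hpt 0).trans f.map_pt.symm
    · exact (hΦ a t 0).trans (h0 a t)
  · refine Susp.addPt_induction ?_ fun a t => ?_
    · exact (hpt 1).trans g.map_pt.symm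
    · exact (hΦ a t 1).trans (h1 a t)
  · rintro s y rfl
    exact (hpt s).trans f.map_pt.symm

/-- The map `ΣΣ(A ⊔ *) → X` given by a cylinder of loops that is constant over the base of the
circle. -/
theorem IsLoopCylinder.exists_map {G : A × I × I → X} (hG : IsLoopCylinder G)
    (hb : ∀ a u, G (a, 0, u) = X.pt) : ∃ f : PtdMap (Susp (Susp (AddPt A))) X,
      ∀ a t u, f (Susp.point _ (Susp.point (AddPt A) (AddPt.of a) t) u) = G (a, t, u) := by
  have hc := hG.continuous
  obtain ⟨Φ, hpt, hΦ⟩ := Susp.exists_continuous_addPt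
    (⟨fun p : (A × I) × I => G (p.1.1, p.1.2, p.2), by fun_prop⟩ : C((A × I) × I, X))
    -- Only `t = 0` is assumed constant; periodicity supplies the other end of the suspension.
    hb (fun a u => (hG.periodic a u).symm.trans (hb a u))
  refine ⟨Susp.ofLoops (fun y => ⟨Φ.curry y, ?_, ?_⟩) Φ.continuous (Path.ext (funext hpt)),
    hΦ⟩
  · exact Susp.addPt_induction (p := fun y => Φ (y, 0) = X.pt) (hpt 0) (fun a t => (hΦ a t 0).trans (hG.left a t)) y
  · exact Susp.addPt_induction (p := fun y => Φ (y, 1) = X.pt) (hpt 1) (fun a t => (hΦ a t 1).trans (hG.right a t)) y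

/-- A homotopy on the double suspension is a cylinder with the homotopy parameter in its base. It
descends through the inner suspension with the homotopy and loop parameters together as the locally
compact factor `I × I`. -/
theorem Susp.homotopic_of_cylinder {f g : PtdMap (Susp (Susp (AddPt A))) X}
    {K : (I × A) × I × I → X} (hK : IsLoopCylinder K) (hb : ∀ a u, K (a, 0, u) = X.pt)
    (h0 : ∀ a t u, K ((0, a), t, u) = f (Susp.point _ (Susp.point (AddPt A) (AddPt.of a) t) u))
    (h1 : ∀ a t u, K ((1, a), t, u) = g (Susp.point _ (Susp.point (AddPt A) (AddPt.of a) t) u)) :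
    f.Homotopic g := by
  have hc := hK.continuous
  obtain ⟨Φ, hpt, hΦ⟩ := Susp.exists_continuous_addPt
    (⟨fun p : (A × I) × (I × I) => K ((p.2.1, p.1.1), p.1.2, p.2.2), by fun_prop⟩ :
      C((A × I) × (I × I), X))
    (fun a z => hb (z.1, a) z.2) (fun a z => (hK.periodic _ _).symm.trans (hb (z.1, a) z.2))
  refine Susp.homotopic_of_loops (fun p => ⟨⟨fun u => Φ (p.2, p.1, u), by fun_prop⟩, ?_, ?_⟩)
    ?_ ?_ ?_ ?_
  · exact Susp.addPt_induction (p := fun y => Φ (y, p.1, 0) = X.pt) (hpt (p.1, 0))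
      (fun a t => (hΦ a t _).trans (hK.left (p.1, a) t)) p.2
  · exact Susp.addPt_induction (p := fun y => Φ (y, p.1, 1) = X.pt) (hpt (p.1, 1))
      (fun a t => (hΦ a t _).trans (hK.right (p.1, a) t)) p.2
  · exact Φ.continuous.comp (f := fun q : (I × Susp (AddPt A)) × I => (q.1.2, q.1.1, q.2))
      (by fun_prop)
  · intro s
    exact Path.ext (funext fun u => hpt (s, u))
  · intro y
    refine Path.ext (funext fun u => ?_)
    refine Susp.addPt_induction (p := fun y => Φ (y, 0, u) = f (Susp.point _ y u)) ?_
      (fun a t => (hΦ a t (0, u)).trans (h0 a t u)) y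
    rw [Susp.point_pt, f.map_pt]
    exact hpt (0, u)
  · intro y
    refine Path.ext (funext fun u => ?_)
    refine Susp.addPt_induction (p := fun y => Φ (y, 1, u) = g (Susp.point _ y u)) ?_
      (fun a t => (hΦ a t (1, u)).trans (h1 a t u)) y
    rw [Susp.point_pt, g.map_pt]
    exact hpt (1, u)

end Construction

/-! ### The split exact sequence of a product with a circle -/

section CircleProduct

variable {W : Type u} {A : Type v} [TopologicalSpace W] [TopologicalSpace A]
  (e : W ≃ₜ A × UnitAddCircle) {X : PtdSpace.{w}}

/-- The projection `W ≅ A × S¹ → A`. -/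
def circleProj : C(W, A) := ⟨fun x => (e x).1, by fun_prop⟩

/-- The inclusion `A ≅ A × 0 → A × S¹ ≅ W`. -/
def circleIncl : C(A, W) := ⟨fun a => e.symm (a, 0), by fun_prop⟩

/-- The map `W ⊔ * → Σ(A ⊔ *)`, `(a, z) ↦ [a, z]`, that collapses `A ⊔ *`. -/
noncomputable def circleCollapse : PtdMap (AddPt W) (Susp (AddPt A)) where
  toMap := ⟨Sum.elim
      (fun x => Susp.point (AddPt A) (AddPt.of (e x).1) (circleParam (e x).2))
      (fun _ => (Susp (AddPt A)).pt), by
    refine Continuous.sumElim ?_ continuous_const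
    exact (continuous_point_circleParam (AddPt A)).comp
      (f := fun x => (AddPt.of (e x).1, (e x).2))
      ((AddPt.continuous_of.comp (by fun_prop)).prodMk (by fun_prop))⟩
  map_pt := rfl

/-- The point of `W` with coordinates `a` and `t`. -/
def circlePoint (a : A) (t : I) : W := e.symm (a, ((t : ℝ) : UnitAddCircle))

theorem continuous_circlePoint : Continuous fun p : A × I => circlePoint e p.1 p.2 := by
  have : Continuous ((↑) : ℝ → UnitAddCircle) := AddCircle.continuous_mk' 1
  unfold circlePoint
  fun_prop

theorem circlePoint_zero_eq_one (a : A) : circlePoint e a 0 = circlePoint e a 1 := by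
  have : (((1 : I) : ℝ) : UnitAddCircle) = ((0 : I) : ℝ) := AddCircle.coe_period (1 : ℝ)
  simp only [circlePoint, this]

theorem circlePoint_circleParam (x : W) :
    circlePoint e (e x).1 (circleParam (e x).2) = x := by
  simp only [circlePoint, coe_circleParam]
  exact e.symm_apply_apply x

/-- A map `Σ(W ⊔ *) → X` as a cylinder of loops. -/
def cylinder (f : Susp (AddPt W) → X) (p : A × I × I) : X :=
  f (Susp.point (AddPt W) (AddPt.of (circlePoint e p.1 p.2.1)) p.2.2)

/-- Regarding a homotopy as one cylinder over `I × A` allows it to be normalized as a whole. -/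
theorem homotopy_isLoopCylinder {f g : PtdMap (Susp (AddPt W)) X}
    (H : f.toMap.HomotopyRel g.toMap {(Susp (AddPt W)).pt}) :
    IsLoopCylinder fun p : (I × A) × I × I =>
      cylinder e (fun y => H (p.1.1, y)) (p.1.2, p.2) := by
  have hH : ∀ s, H (s, (Susp (AddPt W)).pt) = X.pt := fun s =>
    (H.prop' s (Susp (AddPt W)).pt rfl).trans f.map_pt
  refine ⟨?_, ?_, ?_, ?_⟩
  · refine H.continuous.comp (continuous_fst.fst.prodMk ?_)
    refine Susp.continuous_point.comp (f := fun p : (I × A) × I × I =>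
      (AddPt.of (circlePoint e p.1.2 p.2.1), p.2.2)) ?_
    exact (AddPt.continuous_of.comp ((continuous_circlePoint e).comp
      (f := fun p : (I × A) × I × I => (p.1.2, p.2.1)) (by fun_prop))).prodMk (by fun_prop)
  · intro b u
    simp only [cylinder, circlePoint_zero_eq_one]
  · intro b t
    simp only [cylinder]
    rw [Susp.point_zero, hH]
  · intro b t
    simp only [cylinder]
    rw [Susp.point_one, hH]

theorem cylinder_isLoopCylinder (f : PtdMap (Susp (AddPt W)) X) :
    IsLoopCylinder (cylinder e f) := by
  have h := homotopy_isLoopCylinder e (ContinuousMap.HomotopyRel.refl f.toMap _)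
  exact ⟨h.continuous.comp (f := fun p : A × I × I => (((0 : I), p.1), p.2)) (by fun_prop),
    fun a => h.periodic (0, a), fun a => h.left (0, a), fun a => h.right (0, a)⟩

/-- The map `ΣΣ(A ⊔ *) → X` obtained from a map `f` on `Σ(W ⊔ *)` by making
`f * (f restricted to A)⁻¹` constant over `A`. -/
noncomputable def normalize (f : PtdMap (Susp (AddPt W)) X) :
    PtdMap (Susp (Susp (AddPt A))) X :=
  Classical.choose (((cylinder_isLoopCylinder e f).slideHomotopy_isLoopCylinder 1).exists_map
    (cylinder_isLoopCylinder e f).slideHomotopy_one_base)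

theorem normalize_point (f : PtdMap (Susp (AddPt W)) X) (a : A) (t u : I) :
    normalize e f (Susp.point _ (Susp.point (AddPt A) (AddPt.of a) t) u) =
      slideHomotopy (cylinder e f) 1 (a, t, u) :=
  Classical.choose_spec
    (((cylinder_isLoopCylinder e f).slideHomotopy_isLoopCylinder 1).exists_map
      (cylinder_isLoopCylinder e f).slideHomotopy_one_base) a t u

/-- Normalization works separately over each point of the base, so normalizing the cylinder over `I
× A` restricts to `normalize e f` and `normalize e g` at the ends. -/
theorem normalize_homotopic {f g : PtdMap (Susp (AddPt W)) X} (h : f.Homotopic g) :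
    (normalize e f).Homotopic (normalize e g) := by
  obtain ⟨H⟩ := h
  have hK := homotopy_isLoopCylinder e H
  refine Susp.homotopic_of_cylinder (hK.slideHomotopy_isLoopCylinder 1)
    hK.slideHomotopy_one_base ?_ ?_
  · intro a t u
    rw [normalize_point]
    simp only [slideHomotopy, slide, cylinder, ContinuousMap.HomotopyWith.apply_zero]
  · intro a t u
    rw [normalize_point]
    simp only [slideHomotopy, slide, cylinder, ContinuousMap.HomotopyWith.apply_one]

theorem slideHomotopy_cylinder_zero (f : PtdMap (Susp (AddPt W)) X) (a : A) (t u : I) :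
    slideHomotopy (cylinder e f) 0 (a, t, u) =
      (Susp.loop f (AddPt.of (circlePoint e a t))).trans
        (Susp.loop f (AddPt.of (circlePoint e a 0))).symm u := by
  rw [slideHomotopy_zero, Path.trans_apply]
  have h0 := u.2.1
  have h1 := u.2.2
  split_ifs with h
  · rw [clamp, Set.projIcc_of_mem zero_le_one ⟨by linarith, by linarith⟩]
    rfl
  · rw [clamp, Set.projIcc_of_mem zero_le_one ⟨by linarith, by linarith⟩]
    -- The reversed second half has parameter `1 - (2u - 1) = 2 - 2u`.
    refine congrArg (fun v => f (Susp.point (AddPt W) (AddPt.of (circlePoint e a 0)) v)) ?_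
    refine Subtype.ext ?_
    simp only [unitInterval.coe_symm_eq]
    ring

/-- Pulling back the normalization of `f` gives `f * (r^* s^* f)⁻¹`. -/
theorem pull_normalize (f : PtdMap (Susp (AddPt W)) X) :
    (Susp.mulMap f (Susp.invMap (f.comp
      (Susp.map (AddPt.map ((circleIncl e).comp (circleProj e))))))).Homotopic
      ((normalize e f).comp (Susp.map (circleCollapse e))) := by
  have hG := cylinder_isLoopCylinder e f
  have hc := hG.continuous_slideHomotopy
  -- Every stage is periodic, so the whole homotopy descends from `A × I` to `W`, not only its ends.
  have hcirc := continuous_comp_circleParam (Z := I × A × I)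
    (F := fun p => slideHomotopy (cylinder e f) p.1.1 (p.1.2.1, p.2, p.1.2.2))
    (hc.comp (by fun_prop : Continuous fun p : (I × A × I) × I =>
      (p.1.1, p.1.2.1, p.2, p.1.2.2)))
    (fun z => (hG.slideHomotopy_isLoopCylinder z.1).periodic _ _)
  refine Susp.homotopic_of_addPt
    (fun p => slideHomotopy (cylinder e f) p.1 ((e p.2.1).1, circleParam (e p.2.1).2, p.2.2))
    (hcirc.comp (by fun_prop : Continuous fun p : I × W × I =>
      ((p.1, (e p.2.1).1, p.2.2), (e p.2.1).2))) ?_ ?_ ?_ ?_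
  · intro s x
    exact (hG.slideHomotopy_isLoopCylinder s).left _ _
  · intro s x
    exact (hG.slideHomotopy_isLoopCylinder s).right _ _
  · intro x u
    rw [slideHomotopy_cylinder_zero, circlePoint_circleParam]
    rfl
  · intro x u
    exact (normalize_point e f _ _ _).symm

/-- The representative of the circle coordinate differs from `t` only at `t = 1`, and `[a, 0] = [a,
1]` in the suspension. -/
theorem cylinder_comp_collapse (f : PtdMap (Susp (Susp (AddPt A))) X) (a : A) (t u : I) :
    cylinder e (f.comp (Susp.map (circleCollapse e))) (a, t, u) =
      f (Susp.point _ (Susp.point (AddPt A) (AddPt.of a) t) u) := by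
  change f (Susp.point _ (Susp.point (AddPt A) (AddPt.of (e (circlePoint e a t)).1)
    (circleParam (e (circlePoint e a t)).2)) u) = _
  simp only [circlePoint, e.apply_symm_apply]
  refine congrArg (fun y => f (Susp.point _ y u))
    (apply_circleParam (fun t => Susp.point (AddPt A) (AddPt.of a) t) ?_ t)
  exact (Susp.point_zero _).trans (Susp.point_one _).symm

/-- The normalization of a pulled back map `f` is homotopic to `f`. -/
theorem normalize_pull (f : PtdMap (Susp (Susp (AddPt A))) X) :
    (Susp.mulMap f (Susp.invMap (PtdMap.const _ _))).Homotopic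
      (normalize e (f.comp (Susp.map (circleCollapse e)))) := by
  have hG := cylinder_isLoopCylinder e (f.comp (Susp.map (circleCollapse e)))
  -- Constancy over the base persists along the homotopy, which therefore lives on `ΣΣ(A ⊔ *)`; it
  -- also makes the inverted factor at time `0` the constant loop.
  have hb : ∀ a u, cylinder e (f.comp (Susp.map (circleCollapse e))) (a, 0, u) = X.pt := by
    intro a u
    rw [cylinder_comp_collapse, Susp.point_zero, Susp.point_pt]
    exact f.map_pt
  refine Susp.homotopic_of_cylinder
    (K := fun p => slideHomotopy (cylinder e (f.comp (Susp.map (circleCollapse e)))) p.1.1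
      (p.1.2, p.2)) ⟨?_, ?_, ?_, ?_⟩ ?_ ?_ ?_
  · exact hG.continuous_slideHomotopy.comp (by fun_prop : Continuous
      fun p : (I × A) × I × I => (p.1.1, p.1.2, p.2))
  · exact fun b => (hG.slideHomotopy_isLoopCylinder b.1).periodic b.2
  · exact fun b => (hG.slideHomotopy_isLoopCylinder b.1).left b.2
  · exact fun b => (hG.slideHomotopy_isLoopCylinder b.1).right b.2
  · exact fun b u => slideHomotopy_base b.1 b.2 (hb b.2) u
  · intro a t u
    rw [slideHomotopy_cylinder_zero]
    change _ = (Susp.loop f (Susp.point (AddPt A) (AddPt.of a) t)).trans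
      (Path.refl X.pt).symm u
    congr 2
    · ext v
      exact cylinder_comp_collapse e f a t v
    · ext v
      exact hb a (unitInterval.symm v)
  · intro a t u
    exact (normalize_point e _ a t u).symm

/-- Normalization is a left inverse on homotopy classes; it need not be a homomorphism. -/
theorem pullHom_collapse_injective :
    Function.Injective (Susp.pullHom (circleCollapse e) X) := by
  have key : ∀ f : PtdMap (Susp (Susp (AddPt A))) X,
      HoClass.mk f = HoClass.mk (normalize e (f.comp (Susp.map (circleCollapse e)))) := by
    intro f
    have h : HoClass.mk f * (1 : HoClass (Susp (Susp (AddPt A))) X)⁻¹ =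
      HoClass.mk (normalize e (f.comp (Susp.map (circleCollapse e)))) :=
      Quotient.sound (normalize_pull e f)
    rwa [inv_one, mul_one] at h
  intro a b h
  induction a using Quotient.inductionOn with | h f => ?_
  induction b using Quotient.inductionOn with | h g => ?_
  exact (key f).trans ((Quotient.sound (normalize_homotopic e (Quotient.exact h))).trans
    (key g).symm)

/-- The witness is the normalization of a representative. On the kernel of restriction to `A` the
correction factor is trivial, which gives exactness in the middle. -/
theorem exists_pullHom_collapse_eq (b : HoClass (Susp (AddPt W)) X) :
    ∃ a, Susp.pullHom (circleCollapse e) X a =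
      b * (Susp.pullHom (AddPt.map (circleProj e)) X
        (Susp.pullHom (AddPt.map (circleIncl e)) X b))⁻¹ := by
  induction b using Quotient.inductionOn with | h f => ?_
  refine ⟨HoClass.mk (normalize e f), ?_⟩
  refine (Quotient.sound (pull_normalize e f)).symm.trans ?_
  change HoClass.mk f * (HoClass.mk _)⁻¹ = HoClass.mk f * (HoClass.mk _)⁻¹
  congr 3
  refine Susp.ext_loop fun y => ?_
  rcases y with x | ⟨⟩ <;> rfl

end CircleProduct

/-! ### The split extension and its semidirect product -/

section CircleProduct

variable {W : Type u} {A : Type v} [TopologicalSpace W] [TopologicalSpace A]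
  (e : W ≃ₜ A × UnitAddCircle) (X : PtdSpace.{w})

theorem pullHom_incl_comp_pullHom_proj :
    (Susp.pullHom (AddPt.map (circleIncl e)) X).comp
      (Susp.pullHom (AddPt.map (circleProj e)) X) = MonoidHom.id _ := by
  refine MonoidHom.ext fun b => ?_
  induction b using Quotient.inductionOn with | h f => ?_
  refine congrArg HoClass.mk (Susp.ext_loop fun y => ?_)
  change Susp.loop f (AddPt.map (circleProj e) (AddPt.map (circleIncl e) y)) = _
  congr 1
  rcases y with a | ⟨⟩
  · exact congrArg AddPt.of (congrArg Prod.fst (e.apply_symm_apply (a, 0)))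
  · rfl

theorem pullHom_incl_comp_pullHom_collapse (a : HoClass (Susp (Susp (AddPt A))) X) :
    Susp.pullHom (AddPt.map (circleIncl e)) X (Susp.pullHom (circleCollapse e) X a) = 1 := by
  induction a using Quotient.inductionOn with | h f => ?_
  refine congrArg HoClass.mk (Susp.ext_loop fun y => ?_)
  refine Eq.trans (b := Susp.loop f (Susp (AddPt A)).pt) ?_ (Susp.loop_pt f)
  change Susp.loop f (circleCollapse e (AddPt.map (circleIncl e) y)) = _
  refine congrArg (Susp.loop f) ?_
  rcases y with a | ⟨⟩
  · change Susp.point (AddPt A) (AddPt.of (e (e.symm (a, 0))).1)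
      (circleParam (e (e.symm (a, 0))).2) = _
    rw [e.apply_symm_apply, circleParam_zero, Susp.point_zero]
  · rfl

/-- The split extension `[ΣΣ(A ⊔ *), X] → [Σ(W ⊔ *), X] → [Σ(A ⊔ *), X]` for `W ≅ A × S¹`. -/
noncomputable def circleExtension : GroupExtension (HoClass (Susp (Susp (AddPt A))) X)
    (HoClass (Susp (AddPt W)) X) (HoClass (Susp (AddPt A)) X) where
  inl := Susp.pullHom (circleCollapse e) X
  rightHom := Susp.pullHom (AddPt.map (circleIncl e)) X
  inl_injective := pullHom_collapse_injective e
  range_inl_eq_ker_rightHom := by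
    refine le_antisymm ?_ fun b hb => ?_
    · rintro _ ⟨a, rfl⟩
      exact pullHom_incl_comp_pullHom_collapse e X a
    · obtain ⟨a, ha⟩ := exists_pullHom_collapse_eq e b
      rw [MonoidHom.mem_ker.mp hb, map_one, inv_one, mul_one] at ha
      exact ⟨a, ha⟩
  rightHom_surjective b := ⟨_, DFunLike.congr_fun (pullHom_incl_comp_pullHom_proj e X) b⟩

/-- The splitting of `circleExtension` by the projection `W → A`. -/
noncomputable def circleSplitting : (circleExtension e X).Splitting where
  toMonoidHom := Susp.pullHom (AddPt.map (circleProj e)) X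
  rightInverse_rightHom b := DFunLike.congr_fun (pullHom_incl_comp_pullHom_proj e X) b

theorem circleSplitting_semidirectProductMulEquiv (a : HoClass (Susp (Susp (AddPt A))) X)
    (b : HoClass (Susp (AddPt A)) X) :
    (circleSplitting e X).semidirectProductMulEquiv ⟨a, b⟩ =
      Susp.pullHom (circleCollapse e) X a * Susp.pullHom (AddPt.map (circleProj e)) X b := rfl

end CircleProduct

/-! ### Naturality and wedges -/

section Wedge

/-- Postcomposition commutes with concatenation of loops. This gives both the naturality of `Θ` and
the formula for `h^*`. -/
theorem HoClass.push_mul {Y : PtdSpace.{u}} {X : PtdSpace.{v}} {Z : PtdSpace.{w}}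
    (k : PtdMap X Z) (a b : HoClass (Susp Y) X) :
    HoClass.push k (a * b) = HoClass.push k a * HoClass.push k b := by
  induction a using Quotient.inductionOn with | h f => ?_
  induction b using Quotient.inductionOn with | h g => ?_
  refine congrArg HoClass.mk (Susp.ext_loop fun y => Path.ext (funext fun t => ?_))
  change k ((Susp.loop f y).trans (Susp.loop g y) t) =
    (Susp.loop (k.comp f) y).trans (Susp.loop (k.comp g) y) t
  rw [Path.trans_apply, Path.trans_apply]
  split_ifs <;> rfl

theorem HoClass.push_pullHom {Y Y' : PtdSpace.{u}} {X : PtdSpace.{v}} {Z : PtdSpace.{w}}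
    (k : PtdMap X Z) (j : PtdMap Y Y') (a : HoClass (Susp Y') X) :
    HoClass.push k (Susp.pullHom j X a) = Susp.pullHom j Z (HoClass.push k a) := by
  induction a using Quotient.inductionOn with | h f => rfl

variable {P : PtdSpace.{u}} {Q : PtdSpace.{v}} {X : PtdSpace.{w}}

/-- The map `P ∨ Q → X` with given restrictions. -/
def Wedge.desc (f : PtdMap P X) (g : PtdMap Q X) : PtdMap (Wedge P Q) X where
  toMap := ⟨Quotient.lift (Sum.elim f g) (by
      have key : ∀ p ∈ ({Sum.inl P.pt, Sum.inr Q.pt} : Set (P ⊕ Q)), Sum.elim f g p = X.pt := by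
        rintro p (rfl | rfl)
        · exact f.map_pt
        · exact g.map_pt
      rintro a b (rfl | ⟨ha, hb⟩)
      · rfl
      · exact (key a ha).trans (key b hb).symm),
    (f.toMap.continuous.sumElim g.toMap.continuous).quotient_lift _⟩
  map_pt := f.map_pt

/-- Pointed homotopies are pointed maps into `C(I, X)`, so two of them glue by the universal
property of the wedge. -/
theorem Wedge.homotopic {f g : PtdMap (Wedge P Q) X}
    (hl : (f.comp (Wedge.inl P Q)).Homotopic (g.comp (Wedge.inl P Q)))
    (hr : (f.comp (Wedge.inr P Q)).Homotopic (g.comp (Wedge.inr P Q))) : f.Homotopic g := by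
  obtain ⟨H⟩ := hl
  obtain ⟨K⟩ := hr
  let curryH : PtdMap P (mapSpace I X) :=
    ⟨(⟨fun p : P × I => H (p.2, p.1), by fun_prop⟩ : C(P × I, X)).curry,
      ContinuousMap.ext fun s => (H.prop' s P.pt rfl).trans (f.comp (Wedge.inl P Q)).map_pt⟩
  let curryK : PtdMap Q (mapSpace I X) :=
    ⟨(⟨fun p : Q × I => K (p.2, p.1), by fun_prop⟩ : C(Q × I, X)).curry,
      ContinuousMap.ext fun s => (K.prop' s Q.pt rfl).trans (f.comp (Wedge.inr P Q)).map_pt⟩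
  let Φ := (Wedge.desc curryH curryK).toMap.uncurry
  refine ⟨⟨⟨⟨fun p => Φ (p.2, p.1), by fun_prop⟩, ?_, ?_⟩, ?_⟩⟩
  · intro p
    induction p using Quotient.inductionOn with | h p => ?_
    rcases p with p | q
    · exact H.apply_zero p
    · exact K.apply_zero q
  · intro p
    induction p using Quotient.inductionOn with | h p => ?_
    rcases p with p | q
    · exact H.apply_one p
    · exact K.apply_one q
  · rintro s p rfl
    exact H.prop' s P.pt rfl

/-- `[P ∨ Q, X] = [P, X] × [Q, X]`. -/
theorem Wedge.bijective_restrict : Function.Bijective fun c : HoClass (Wedge P Q) X =>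
    (HoClass.pull (Wedge.inl P Q) c, HoClass.pull (Wedge.inr P Q) c) := by
  constructor
  · intro c d h
    induction c using Quotient.inductionOn with | h f => ?_
    induction d using Quotient.inductionOn with | h g => ?_
    exact Quotient.sound (Wedge.homotopic (Quotient.exact (congrArg Prod.fst h))
      (Quotient.exact (congrArg Prod.snd h)))
  · rintro ⟨a, b⟩
    induction a using Quotient.inductionOn with | h f => ?_
    induction b using Quotient.inductionOn with | h g => ?_
    exact ⟨HoClass.mk (Wedge.desc f g), rfl⟩

/-- A map that induces bijections on all sets of homotopy classes is a homotopy equivalence. -/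
theorem PtdMap.isHomotopyEquiv_of_bijective {Y Z : PtdSpace.{u}} (h : PtdMap Y Z)
    (hY : Function.Surjective (HoClass.pull h : HoClass Z Y → HoClass Y Y))
    (hZ : Function.Injective (HoClass.pull h : HoClass Z Z → HoClass Y Z)) :
    h.IsHomotopyEquiv := by
  obtain ⟨k, hk⟩ := hY (HoClass.mk (PtdMap.id Y))
  induction k using Quotient.inductionOn with | h k => ?_
  have hkh : (k.comp h).Homotopic (PtdMap.id Y) := Quotient.exact hk
  -- Both `h ∘ k` and the identity pull back along `h` to the class of `h`.
  refine ⟨k, hkh, Quotient.exact (hZ ?_ : HoClass.mk (h.comp k) = HoClass.mk (PtdMap.id Z))⟩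
  exact Quotient.sound (hkh.comp_left h)

end Wedge

/-! ### The comparison map to the wedge -/

section CircleProduct

variable {W : Type u} {A : Type u} [TopologicalSpace W] [TopologicalSpace A]
  (e : W ≃ₜ A × UnitAddCircle)

/-- The comparison map `Σ(W ⊔ *) → ΣΣ(A ⊔ *) ∨ Σ(A ⊔ *)` for `W ≅ A × S¹`. -/
noncomputable def circleToWedge :
    PtdMap (Susp (AddPt W)) (Wedge (Susp (Susp (AddPt A))) (Susp (AddPt A))) :=
  Susp.mulMap ((Wedge.inl _ _).comp (Susp.map (circleCollapse e)))
    ((Wedge.inr _ _).comp (Susp.map (AddPt.map (circleProj e))))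

theorem pull_circleToWedge (X : PtdSpace.{w})
    (c : HoClass (Wedge (Susp (Susp (AddPt A))) (Susp (AddPt A))) X) :
    HoClass.pull (circleToWedge e) c =
      (circleSplitting e X).semidirectProductMulEquiv
        ⟨HoClass.pull (Wedge.inl _ _) c, HoClass.pull (Wedge.inr _ _) c⟩ := by
  induction c using Quotient.inductionOn with | h f => ?_
  -- Pulling back `f` along the comparison map is pushing the class of that map, a product of two
  -- classes, forward along `f`.
  exact HoClass.push_mul f (HoClass.mk ((Wedge.inl _ _).comp (Susp.map (circleCollapse e))))
    (HoClass.mk ((Wedge.inr _ _).comp (Susp.map (AddPt.map (circleProj e)))))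

theorem pull_circleToWedge_bijective (X : PtdSpace.{w}) :
    Function.Bijective (HoClass.pull (circleToWedge e) :
      HoClass (Wedge (Susp (Susp (AddPt A))) (Susp (AddPt A))) X → _) := by
  have h := ((circleSplitting e X).semidirectProductMulEquiv.bijective.comp
    (SemidirectProduct.equivProd (φ := (circleSplitting e X).conjAct)).symm.bijective).comp
    Wedge.bijective_restrict
  exact (funext (pull_circleToWedge e X) : HoClass.pull (circleToWedge e) = _) ▸ h

theorem circleToWedge_isHomotopyEquiv : (circleToWedge e).IsHomotopyEquiv :=
  PtdMap.isHomotopyEquiv_of_bijective _ (pull_circleToWedge_bijective e _).surjective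
    (pull_circleToWedge_bijective e _).injective

end CircleProduct

/-! ### Specialization to tori -/

/-- The homeomorphism `T^{n-1} ≅ T^{n-2} × S¹` that splits off the last coordinate. -/
def torusSplit (n : ℕ) (hn : 1 < n) : Torus (n - 1) ≃ₜ Torus (n - 1 - 1) × UnitAddCircle where
  toFun x := (torusProj n x, torusLast n hn x)
  invFun p i := if h : (i : ℕ) < n - 1 - 1 then p.1 ⟨i, h⟩ else p.2
  left_inv x := by
    funext i
    by_cases h : (i : ℕ) < n - 1 - 1
    · simp only [h, dif_pos]
      rfl
    · simp only [h, dif_neg, not_false_iff]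
      -- An index below `n - 1` but not below `n - 2` is the last one.
      exact congrArg x (Fin.ext (by have := i.2; simp only; omega))
  right_inv p := by
    refine Prod.ext (funext fun i => ?_) ?_
    · exact dif_pos i.2
    · exact dif_neg (lt_irrefl _)
  continuous_toFun := (torusProj n).continuous.prodMk (continuous_apply _)
  continuous_invFun := by
    refine continuous_pi fun i => ?_
    split_ifs <;> fun_prop

end FoxTorus

theorem proposition1 (n : ℕ) (hn : 1 < n) :
    ∃ h : PtdMap (FoxSpace n)
        (Wedge (Susp (FoxSpace (n - 1))) (FoxSpace (n - 1))),
      -- `h : F_n → ΣF_{n-1} ∨ F_{n-1}` is a pointed homotopy equivalence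
      h.IsHomotopyEquiv ∧
      -- `1 → [ΣF_{n-1}, X] → [F_n, X] → [F_{n-1}, X] → 1` is split exact for every `X`
      (∀ X : PtdSpace.{u},
        Function.Injective (foxKernelMap n hn X) ∧
        (foxKernelMap n hn X).range = (foxRestrict n X).ker ∧
        (foxRestrict n X).comp (foxSection n X) = MonoidHom.id _) ∧
      -- the resulting isomorphism `Θ` of `[ΣF_{n-1}, X] ⋊ [F_{n-1}, X]` with `[F_n, X]`
      ∃ (φ : ∀ X : PtdSpace.{u}, HoClass (FoxSpace (n - 1)) X →*
            MulAut (HoClass (Susp (FoxSpace (n - 1))) X))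
        (Θ : ∀ X : PtdSpace.{u},
          HoClass (Susp (FoxSpace (n - 1))) X ⋊[φ X]
            HoClass (FoxSpace (n - 1)) X ≃*
          HoClass (FoxSpace n) X),
        (∀ (X : PtdSpace.{u})
          (a : HoClass (Susp (FoxSpace (n - 1))) X)
          (b : HoClass (FoxSpace (n - 1)) X),
          Θ X ⟨a, b⟩ = foxKernelMap n hn X a * foxSection n X b) ∧
        -- `Θ` is natural in `X`
        (∀ (X X' : PtdSpace.{u}) (k : PtdMap X X')
          (a : HoClass (Susp (FoxSpace (n - 1))) X)
          (b : HoClass (FoxSpace (n - 1)) X),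
          HoClass.push k (Θ X ⟨a, b⟩) =
            Θ X' ⟨HoClass.push k a, HoClass.push k b⟩) ∧
        -- `h^*` is `Θ` under `[ΣF_{n-1} ∨ F_{n-1}, X] = [ΣF_{n-1}, X] × [F_{n-1}, X]`
        (∀ (X : PtdSpace.{u})
          (c : HoClass (Wedge (Susp (FoxSpace (n - 1)))
            (FoxSpace (n - 1))) X),
          HoClass.pull h c =
            Θ X ⟨HoClass.pull (Wedge.inl _ _) c,
              HoClass.pull (Wedge.inr _ _) c⟩) := by
  -- For this `e` the general projection, inclusion and collapse unfold to `torusProj`, `torusIncl`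
  -- and `torusCollapse`, so the general results apply by definitional equality.
  let e := torusSplit n hn
  refine ⟨circleToWedge e, circleToWedge_isHomotopyEquiv e, fun X => ⟨?_, ?_, ?_⟩,
    fun X => (circleSplitting e X).conjAct,
    fun X => (circleSplitting e X).semidirectProductMulEquiv, ?_, ?_, ?_⟩
  · exact (circleExtension e X).inl_injective
  · exact (circleExtension e X).range_inl_eq_ker_rightHom
  · exact pullHom_incl_comp_pullHom_proj e X
  · exact circleSplitting_semidirectProductMulEquiv e
  · intro X X' k a b
    rw [circleSplitting_semidirectProductMulEquiv, circleSplitting_semidirectProductMulEquiv,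
      HoClass.push_mul, HoClass.push_pullHom, HoClass.push_pullHom]
  · exact pull_circleToWedge e
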